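/- Let $n_j,k_j,M_j$ ($j\in\mathbb N$) be sequences of non-negative integers with $1\le k_j\le n_j$ for all large $j$, let $\rho_j>0$ be real numbers with $\rho_j=o(1/k_j)$ as $j\to\infty$, and put $m_j=M_j/n_j$. (The high-dimensional sparse regime $n_j,k_j,m_j\to\infty$, $k_j=o(n_j)$ is included.) For $S\subseteq[n]=\{1,\dots,n\}$ and $\rho>0$, let $U^1,U^2,\dots$ be i.i.d. centred Gaussian vectors in $\mathbb R^n$ with covariance matrix $\Sigma_S$, where $(\Sigma_S)_{ii}=1$, $(\Sigma_S)_{ij}=\rho$ for distinct $i,j\in S$, and $(\Sigma_S)_{ij}=0$ otherwise. (Since $\rho_jk_j\to0$, these are covariance matrices for $\rho=\rho_j$ and $|S|\le k_j$ for all large $j$.) The null hypothesis is $S=\emptyset$ and the alternative is $S\in\mathcal C$, where $\mathcal C=\mathcal C_{n,k}$ is one of the following classes (the same one for all $j$): - $k$-sets: all subsets of $[n]$ of cardinality $k$; - $k$-intervals: all sets $\{z,z+1,\dots,z+k-1\}$ with $1\le z\le n-k+1$; - disjoint $k$-intervals: the sets $\{(i-1)k+1,\dots,ik\}$ with $1\le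 i\le\lfloor n/k\rfloor$. An adaptive sensing strategy $\mathcal A$ with budget $M$ has $M$ rounds. In round $t$ a random, possibly empty, query set $A^t\subseteq[n]$ is drawn from a conditional distribution given the history $(A^s,X^s)_{s<t}$; these conditional distributions form the strategy and do not depend on $S$. Then one observes $X^t\in\mathbb R^n$ with $X^t_i=U^t_i$ for $i\in A^t$ and $X^t_i=0$ for $i\notin A^t$. It is required that $\sum_{t=1}^M|A^t|\le M$ almost surely, under the null and under each alternative. Let $\mathbb P_S^{\mathcal A}$ be the joint law of $(A^1,X^1,\dots,A^M,X^M)$. A test is a measurable $\{0,1\}$-valued function $\phi$ of $(A^1,X^1,\dots,A^M,X^M)$, and the minimax risk is $$R^*_{\mathbf{AS}}=\inf_{\mathcal A,\phi}\Big[\mathbb P_\emptyset^{\mathcal A}(\phi\ne0)+\max_{S\in\mathcal C}\mathbb P_S^{\mathcal A}(\phi\ne1)\Big],$$ the infimum being over all adaptive sensing strategies with budget $M$ and all tests. If the minimax risk $R^*_{\mathbf{AS}}$ for the parameters $(n_j,k_j,M_j,\rho_j)$ and the class $\mathcal C_{n_j,k_j}$ tends to $0$ as $j\to\infty$, then $\rho_jk_j\sqrt{m_j}\to\infty$.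 -/

import Mathlib

open MeasureTheory ProbabilityTheory Filter Topology Asymptotics
open scoped ENNReal

namespace CorrDetect

noncomputable section

/-- The covariance matrix `Σ_S`: unit diagonal, entry `ρ` off the diagonal inside `S`, and `0`
elsewhere. -/
def sigma {n : ℕ} (ρ : ℝ) (S : Finset (Fin n)) : Matrix (Fin n) (Fin n) ℝ :=
  Matrix.of fun i j => if i = j then 1 else if i ∈ S ∧ j ∈ S then ρ else 0

/-- The law of one vector `U^t`: centred Gaussian with covariance matrix `Σ_S`. -/
def sampleLaw {n : ℕ} (ρ : ℝ) (S : Finset (Fin n)) : Measure (EuclideanSpace ℝ (Fin n)) :=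
  multivariateGaussian 0 (sigma ρ S)

/-- All subsets of the `n` coordinates with exactly `k` elements. -/
def kSets (n k : ℕ) : Set (Finset (Fin n)) :=
  {S | S.card = k}

/-- All sets of `k` contiguous coordinates (coordinates are numbered from `0`). -/
def kIntervals (n k : ℕ) : Set (Finset (Fin n)) :=
  {S | ∃ z : ℕ, z + k ≤ n ∧ S = Finset.univ.filter fun i : Fin n => z ≤ i.val ∧ i.val < z + k}

/-- The `⌊n / k⌋` consecutive disjoint blocks `{j k, …, (j + 1) k - 1}`
(coordinates are numbered from `0`). -/
def disjointKIntervals (n k : ℕ) : Set (Finset (Fin n)) :=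
  {S | ∃ j : ℕ, j < n / k ∧
    S = Finset.univ.filter fun i : Fin n => j * k ≤ i.val ∧ i.val < (j + 1) * k}

/-- One round: the query set `A^t` and the observation `X^t`. -/
abbrev Round (n : ℕ) : Type := Finset (Fin n) × (Fin n → ℝ)

/-- The history `H^t` of the first `t` rounds. -/
abbrev History (n t : ℕ) : Type := Fin t → Round n

/-- The observation made of `u` through the query set `a`: the coordinates outside `a` are
replaced by `0`. -/
def mask {n : ℕ} (a : Finset (Fin n)) (u : EuclideanSpace ℝ (Fin n)) : Fin n → ℝ :=
  fun i => if i ∈ a then u i else 0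

/-- The conditional law of the observation `X^t` given the query `A^t`, when the contaminated set
is `S`. -/
def obsKernel {n : ℕ} (ρ : ℝ) (S : Finset (Fin n)) : Kernel (Finset (Fin n)) (Fin n → ℝ) :=
  Kernel.ofFunOfCountable fun a => (sampleLaw ρ S).map (mask a)

instance {n : ℕ} (ρ : ℝ) (S : Finset (Fin n)) : IsMarkovKernel (obsKernel ρ S) where
  isProbabilityMeasure a := by
    have : IsProbabilityMeasure (sampleLaw ρ S) := by unfold sampleLaw; infer_instance
    refine Measure.isProbabilityMeasure_map (Measurable.aemeasurable ?_)
    refine measurable_pi_lambda _ fun i => ?_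
    by_cases hi : i ∈ a <;> simp only [mask, hi, if_true, if_false] <;> fun_prop

/-- A sensing strategy: the conditional distributions of the next query given the history.
`query t` is the conditional law of the query made after `t` rounds have been completed. -/
structure SensingStrategy (n : ℕ) where
  query : (t : ℕ) → Kernel (History n t) (Finset (Fin n))
  isMarkov : ∀ t, IsMarkovKernel (query t)

namespace SensingStrategy

variable {n : ℕ} (𝒜 : SensingStrategy n) (ρ : ℝ) (S : Finset (Fin n))

/-- The conditional law of a round given the history: draw the query by the strategy, then a fresh
observation through that query. -/
def roundKernel (t : ℕ) : Kernel (History n t) (Round n) :=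
  (𝒜.query t) ⊗ₖ ((obsKernel ρ S).prodMkLeft (History n t))

instance (t : ℕ) : IsMarkovKernel (𝒜.roundKernel ρ S t) := by
  have := 𝒜.isMarkov t
  unfold roundKernel
  infer_instance

/-- The joint law `P_S^𝒜` of the first `t` rounds when the contaminated set is `S`. -/
def law : (t : ℕ) → Measure (History n t)
  | 0 => Measure.dirac fun i => i.elim0
  | t + 1 => (law t ⊗ₘ 𝒜.roundKernel ρ S t).map
      fun p => (Fin.snoc (α := fun _ => Round n) p.1 p.2 : History n (t + 1))

lemma measurable_snoc (t : ℕ) : Measurable fun p : History n t × Round n =>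
    (Fin.snoc (α := fun _ => Round n) p.1 p.2 : History n (t + 1)) := by
  refine measurable_pi_lambda _ fun i => ?_
  induction i using Fin.lastCases with
  | last => simpa using measurable_snd
  | cast i => simpa [Function.comp_def] using (measurable_pi_apply i).comp measurable_fst

instance isProbabilityMeasure_law (t : ℕ) : IsProbabilityMeasure (𝒜.law ρ S t) := by
  induction t with
  | zero => unfold law; infer_instance
  | succ t ih => exact Measure.isProbabilityMeasure_map (measurable_snoc t).aemeasurable

end SensingStrategy

/-- The number of coordinate measurements used in a history. -/
def spent {n t : ℕ} (h : History n t) : ℕ := ∑ s, (h s).1.card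

/-- The strategy respects the budget `M` over `M` rounds, almost surely under the null hypothesis
and under every alternative of the class `C`. -/
def SensingStrategy.WithinBudget {n : ℕ} (𝒜 : SensingStrategy n) (ρ : ℝ)
    (C : Set (Finset (Fin n))) (M : ℕ) : Prop :=
  ∀ S ∈ insert ∅ C, ∀ᵐ h ∂(𝒜.law ρ S M), spent h ≤ M

/-- The worst-case risk of a strategy with a test `φ` (`true` means that the null hypothesis is
rejected). -/
def risk {n : ℕ} (ρ : ℝ) (C : Set (Finset (Fin n))) (M : ℕ) (𝒜 : SensingStrategy n)
    (φ : History n M → Bool) : ℝ≥0∞ :=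
  𝒜.law ρ ∅ M {h | φ h ≠ false} + ⨆ S ∈ C, 𝒜.law ρ S M {h | φ h ≠ true}

/-- The minimax risk over all adaptive testing procedures with a budget of `M` coordinate
measurements. -/
def minimaxRisk {n : ℕ} (ρ : ℝ) (C : Set (Finset (Fin n))) (M : ℕ) : ℝ≥0∞ :=
  ⨅ (𝒜 : SensingStrategy n) (_ : 𝒜.WithinBudget ρ C M)
    (φ : History n M → Bool) (_ : Measurable φ), risk ρ C M 𝒜 φ

end

end CorrDetect

namespace CorrDetect

/-! ### Gaussian densities -/

section Gaussian

variable {ι : Type*} [Fintype ι]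

/-! Every class contains the disjoint `k`-blocks, so it suffices to hide `S` among the `N = ⌊n/k⌋`
blocks and bound a divergence on average over them. Put `τ = ρ / (1 - ρ)`. The query distributions
do not depend on `S`, so they cancel in the likelihood ratio of an adaptive history: its logarithm
`Λ_S` is the sum over rounds of the Gaussian log-ratios on `A^t ∩ S` (`lintegral_law`). Under the
null, a round with query `a` has `-E Λ ≤ τ² |a ∩ S|² / 2` (`neg_le_integral_logRatio`), hence
`KL(P_∅ ‖ P_S) ≤ E_∅ ∑ τ² |A^t ∩ S|² / 2` (`neg_integral_historyCost_le`). This direction of the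
divergence is the useful one: the expectation is under the null for every `S`, so the costs of all
blocks can be added under a single law. By disjointness `∑_j |a ∩ B_j|² ≤ k |a|`, so the budget
bounds the total by `τ² k M / 2`, and the average over blocks by `K = τ² k² M / n`, however adaptive
the queries are. If a test accepts with null probability at least `1/2`, a change of measure
(`le_real_law_compl`), averaged over blocks, gives a block whose type II error is at least `exp(-(2K
+ 2)) / 2`; otherwise the type I error exceeds `1/2`. So the risk can vanish only if `ρ² k² m → ∞`.
-/

lemma prod_gaussianPDFReal (x : ι → ℝ) :
    ∏ i, gaussianPDFReal 0 1 (x i) =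
      (√(2 * Real.pi))⁻¹ ^ Fintype.card ι * Real.exp (-(∑ i, x i ^ 2) / 2) := by
  simp only [gaussianPDFReal, Finset.prod_mul_distrib, ← Real.exp_sum]
  simp [Finset.sum_neg_distrib, neg_div, Finset.sum_div]

/-- The standard Gaussian measure on `ι → ℝ` has the product density. -/
lemma pi_gaussianReal_eq_withDensity :
    Measure.pi (fun _ : ι => gaussianReal 0 1) =
      volume.withDensity fun x => ENNReal.ofReal (∏ i, gaussianPDFReal 0 1 (x i)) := by
  refine Measure.pi_eq fun s hs => ?_
  have hint (i : ι) : Integrable (gaussianPDFReal 0 1) (volume.restrict (s i)) :=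
    (integrable_gaussianPDFReal 0 1).restrict
  have hnn (i : ι) : 0 ≤ ∫ x in s i, gaussianPDFReal 0 1 x :=
    integral_nonneg fun x => gaussianPDFReal_nonneg 0 1 x
  rw [withDensity_apply _ (MeasurableSet.univ_pi hs), volume_pi, Measure.restrict_pi_pi,
    ← ofReal_integral_eq_lintegral_ofReal
      (Integrable.fintype_prod (f := fun _ => gaussianPDFReal 0 1) hint)
      (ae_of_all _ fun x => Finset.prod_nonneg fun i _ => gaussianPDFReal_nonneg 0 1 _),
    integral_fintype_prod_eq_prod (fun _ => gaussianPDFReal 0 1),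
    ENNReal.ofReal_prod_of_nonneg fun i _ => hnn i]
  refine Finset.prod_congr rfl fun i _ => ?_
  rw [gaussianReal_apply_eq_integral 0 one_ne_zero]

variable [DecidableEq ι]

/-- Change of variables for the standard Gaussian measure under an invertible matrix. -/
lemma map_mulVec_pi_gaussianReal (A : Matrix ι ι ℝ) (hA : A.det ≠ 0)
    (N : (ι → ℝ) → ι → ℝ) (hN : Measurable N) (hNA : ∀ x, N (A.mulVec x) = x) :
    (Measure.pi fun _ : ι => gaussianReal 0 1).map A.mulVec =
      (Measure.pi fun _ : ι => gaussianReal 0 1).withDensity fun y =>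
        ENNReal.ofReal (|A.det|⁻¹ * Real.exp ((∑ i, y i ^ 2 - ∑ i, N y i ^ 2) / 2)) := by
  have hmA : Measurable (A.mulVec : (ι → ℝ) → ι → ℝ) :=
    (A.mulVecLin.continuous_of_finiteDimensional).measurable
  have hg : Measurable fun x : ι → ℝ => ENNReal.ofReal (∏ i, gaussianPDFReal 0 1 (x i)) := by
    refine ENNReal.measurable_ofReal.comp (Finset.measurable_prod _ fun i _ => ?_)
    exact (measurable_gaussianPDFReal 0 1).comp (measurable_pi_apply i)
  have hD : Measurable fun y : ι → ℝ =>
      ENNReal.ofReal (|A.det|⁻¹ * Real.exp ((∑ i, y i ^ 2 - ∑ i, N y i ^ 2) / 2)) := by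
    fun_prop
  refine Measure.ext_of_lintegral _ fun f hf => ?_
  rw [lintegral_map hf hmA, lintegral_withDensity_eq_lintegral_mul _ hD hf,
    pi_gaussianReal_eq_withDensity,
    lintegral_withDensity_eq_lintegral_mul _ hg (g := fun x => f (A.mulVec x)) (hf.comp hmA),
    lintegral_withDensity_eq_lintegral_mul _ hg (hD.mul hf)]
  have hF : Measurable fun y : ι → ℝ =>
      ENNReal.ofReal (∏ i, gaussianPDFReal 0 1 (N y i)) * f y := (hg.comp hN).mul hf
  -- Since `N` undoes `A`, the integrand is a function of `A x` alone and the integral can be pushed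
  -- forward to a multiple of Lebesgue measure.
  have key : ∫⁻ x : ι → ℝ, ENNReal.ofReal (∏ i, gaussianPDFReal 0 1 (N (A.mulVec x) i)) *
      f (A.mulVec x) = ∫⁻ y, ENNReal.ofReal (∏ i, gaussianPDFReal 0 1 (N y i)) * f y
        ∂(volume.map (Matrix.toLin' A)) := by
    exact (lintegral_map hF hmA).symm
  simp only [hNA] at key
  simp only [Pi.mul_apply]
  rw [key, Real.map_matrix_volume_pi_eq_smul_volume_pi hA, lintegral_smul_measure, smul_eq_mul,
    ← lintegral_const_mul _ hF]
  refine lintegral_congr fun y => ?_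
  rw [← mul_assoc, ← mul_assoc, ← ENNReal.ofReal_mul (abs_nonneg _),
    ← ENNReal.ofReal_mul (Finset.prod_nonneg fun i _ => gaussianPDFReal_nonneg 0 1 _)]
  congr 2
  have hexp : Real.exp (-(∑ i, N y i ^ 2) / 2) = Real.exp (-(∑ i, y i ^ 2) / 2) *
      Real.exp ((∑ i, y i ^ 2 - ∑ i, N y i ^ 2) / 2) := by
    rw [← Real.exp_add]
    ring_nf
  rw [prod_gaussianPDFReal, prod_gaussianPDFReal, abs_inv, hexp]
  ring

/-- The image of a centred Gaussian measure under a linear map. -/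
lemma map_toEuclideanCLM_multivariateGaussian {V : Matrix ι ι ℝ} (hV : V.PosSemidef)
    (A : Matrix ι ι ℝ) :
    (multivariateGaussian 0 V).map (Matrix.toEuclideanCLM (𝕜 := ℝ) A) =
      multivariateGaussian 0 (A * V * A.transpose) := by
  have hP : (A * V * A.transpose).PosSemidef := by
    simpa using hV.mul_mul_conjTranspose_same A
  refine Measure.ext_of_charFun (funext fun t => ?_)
  have h : charFun ((multivariateGaussian 0 V).map (Matrix.toEuclideanCLM (𝕜 := ℝ) A)) t =
      charFun (multivariateGaussian 0 V) (Matrix.toEuclideanCLM (𝕜 := ℝ) A.transpose t) := by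
    rw [charFun_apply, charFun_apply, integral_map (by fun_prop) (by fun_prop)]
    refine integral_congr_ae (ae_of_all _ fun x => ?_)
    have : inner ℝ (Matrix.toEuclideanCLM (𝕜 := ℝ) A x) t =
        inner ℝ x (Matrix.toEuclideanCLM (𝕜 := ℝ) A.transpose t) := by
      rw [Matrix.inner_toEuclideanCLM, real_inner_comm, Matrix.inner_toEuclideanCLM,
        Matrix.dotProduct_mulVec, Matrix.mulVec_transpose, dotProduct_comm]
    simp only [this]
  rw [h, charFun_multivariateGaussian hV, charFun_multivariateGaussian hP]
  simp only [inner_zero_right, Matrix.ofLp_toEuclideanCLM]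
  rw [← Matrix.mulVec_mulVec, ← Matrix.mulVec_mulVec, Matrix.dotProduct_mulVec t.ofLp A,
    ← Matrix.mulVec_transpose]

end Gaussian

noncomputable section

/-! ### The likelihood ratio of one observation -/

/-- The logarithm of the density of the centred Gaussian law with covariance `sigma ρ T` with
respect to the standard Gaussian law, in terms of `τ = ρ / (1 - ρ)`. -/
def logRatio {n : ℕ} (τ : ℝ) (T : Finset (Fin n)) (x : Fin n → ℝ) : ℝ :=
  (T.card * Real.log (1 + τ) - Real.log (1 + τ * T.card) - τ * ∑ i ∈ T, x i ^ 2
    + τ * (1 + τ) / (1 + τ * T.card) * (∑ i ∈ T, x i) ^ 2) / 2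

/-- The coefficient of the rank-one part of `factor`. -/
def factorCoeff (τ s : ℝ) : ℝ := τ / (1 + √(1 + τ * s))

/-- A square root of `sigma ρ T`, in terms of `τ = ρ / (1 - ρ)`. -/
def factor {n : ℕ} (τ : ℝ) (T : Finset (Fin n)) : Matrix (Fin n) (Fin n) ℝ :=
  Matrix.diagonal (fun i => if i ∈ T then (√(1 + τ))⁻¹ else 1) *
    (1 + Matrix.replicateCol Unit (fun i => if i ∈ T then factorCoeff τ T.card else 0) *
      Matrix.replicateRow Unit (fun i => if i ∈ T then (1 : ℝ) else 0))

section Factor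

variable {n : ℕ} {τ : ℝ} (T : Finset (Fin n))

/-- On `T`, `sigma` is `(1 + τ)⁻¹ (I + τ 11ᵀ)`. With `b = factorCoeff τ s`, the matrix `I + b 11ᵀ`
is a square root of `I + τ 11ᵀ` exactly when its eigenvalue `1 + b s` along `1` squares to `1 + τ
s`. The quotient defining `b` also makes sense for `s = 0`. -/
lemma one_add_factorCoeff_mul {s : ℝ} (hτ : 0 ≤ τ) (hs : 0 ≤ s) :
    1 + factorCoeff τ s * s = √(1 + τ * s) := by
  have h := Real.sq_sqrt (show 0 ≤ 1 + τ * s by positivity)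
  have h0 := Real.sqrt_nonneg (1 + τ * s)
  unfold factorCoeff
  field_simp
  linarith

lemma factorCoeff_mul_one_add_sqrt (τ s : ℝ) :
    factorCoeff τ s * (1 + √(1 + τ * s)) = τ := by
  have h0 := Real.sqrt_nonneg (1 + τ * s)
  unfold factorCoeff
  field_simp

lemma factor_apply (i j : Fin n) :
    factor τ T i j = (if i ∈ T then (√(1 + τ))⁻¹ else 1) *
      ((if i = j then 1 else 0) + if i ∈ T then (if j ∈ T then factorCoeff τ T.card else 0)
        else 0) := by
  rw [factor, Matrix.diagonal_mul, Matrix.add_apply, Matrix.one_apply,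
    Matrix.mul_apply]
  simp only [Finset.univ_unique, Finset.sum_singleton, Matrix.replicateCol_apply,
    Matrix.replicateRow_apply]
  split_ifs <;> simp

lemma factor_mulVec (x : Fin n → ℝ) (i : Fin n) :
    (factor τ T).mulVec x i =
      if i ∈ T then (√(1 + τ))⁻¹ * (x i + factorCoeff τ T.card * ∑ j ∈ T, x j) else x i := by
  simp only [Matrix.mulVec, dotProduct, factor_apply]
  by_cases hi : i ∈ T
  · simp [hi, mul_assoc, add_mul, ← Finset.mul_sum, Finset.sum_add_distrib, ite_mul]
  · simp [hi]

lemma factor_det (hτ : 0 ≤ τ) :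
    (factor τ T).det = (√(1 + τ))⁻¹ ^ T.card * √(1 + τ * T.card) := by
  rw [factor, Matrix.det_mul, Matrix.det_diagonal,
    Matrix.det_one_add_replicateCol_mul_replicateRow,
    ← one_add_factorCoeff_mul hτ (Nat.cast_nonneg T.card)]
  simp [dotProduct, Finset.prod_ite_mem, mul_comm]

lemma factor_mul_transpose (hτ : 0 ≤ τ) :
    factor τ T * (factor τ T).transpose = sigma (τ / (1 + τ)) T := by
  have hr : (√(1 + τ))⁻¹ * (√(1 + τ))⁻¹ = (1 + τ)⁻¹ := by
    rw [← mul_inv, Real.mul_self_sqrt (by positivity)]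
  have hb : 2 * factorCoeff τ T.card + factorCoeff τ T.card * factorCoeff τ T.card * T.card
      = τ := by
    have h1 := one_add_factorCoeff_mul hτ (Nat.cast_nonneg T.card)
    have h2 := factorCoeff_mul_one_add_sqrt τ T.card
    rw [← h1] at h2
    linarith
  ext i l
  have hrow : (factor τ T * (factor τ T).transpose) i l =
      (factor τ T).mulVec (fun j => factor τ T l j) i := by
    simp [Matrix.mul_apply, Matrix.mulVec, dotProduct]
  rw [hrow, factor_mulVec]
  simp only [factor_apply, sigma, Matrix.of_apply]
  by_cases hi : i ∈ T <;> by_cases hl : l ∈ T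
  · have hsum : ∑ j ∈ T, (√(1 + τ))⁻¹ * ((if l = j then 1 else 0) +
        if j ∈ T then factorCoeff τ T.card else 0) =
        (√(1 + τ))⁻¹ * (1 + T.card * factorCoeff τ T.card) := by
      rw [← Finset.mul_sum, Finset.sum_add_distrib]
      simp [hl]
    simp only [hi, hl, if_true, hsum, and_self]
    have : (√(1 + τ))⁻¹ * ((√(1 + τ))⁻¹ * ((if l = i then 1 else 0) + factorCoeff τ T.card) +
        factorCoeff τ T.card * ((√(1 + τ))⁻¹ * (1 + T.card * factorCoeff τ T.card))) =
        (1 + τ)⁻¹ * ((if l = i then 1 else 0) + τ) := by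
      rw [← hr]
      linear_combination (√(1 + τ))⁻¹ * (√(1 + τ))⁻¹ * hb
    rw [this]
    by_cases h : i = l
    · subst h; simp; field_simp
    · simp [h, Ne.symm h]; field_simp
  · have : i ≠ l := fun h => hl (h ▸ hi)
    simp [hi, hl, this, this.symm]
  · have : i ≠ l := fun h => hi (h ▸ hl)
    simp [hi, hl, this, this.symm]
  · simp [hi, hl, eq_comm]

lemma sigma_posSemidef (hτ : 0 ≤ τ) : (sigma (τ / (1 + τ)) T).PosSemidef := by
  rw [← factor_mul_transpose T hτ]
  simpa using Matrix.posSemidef_self_mul_conjTranspose (factor τ T)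

lemma abs_det_factor_inv (hτ : 0 ≤ τ) :
    |(factor τ T).det|⁻¹ =
      Real.exp ((T.card * Real.log (1 + τ) - Real.log (1 + τ * T.card)) / 2) := by
  have h1 : 0 < √(1 + τ) := Real.sqrt_pos.2 (by positivity)
  have h2 : 0 < √(1 + τ * T.card) := Real.sqrt_pos.2 (by positivity)
  rw [factor_det T hτ, abs_of_pos (by positivity), mul_inv, inv_pow, inv_inv, sub_div,
    Real.exp_sub, mul_div_assoc, ← Real.log_sqrt (by positivity), ← Real.log_sqrt (by positivity),
    Real.exp_nat_mul, Real.exp_log h1, Real.exp_log h2, div_eq_mul_inv]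

/-- The inverse of `factor`, as a function. -/
def factorInv (τ : ℝ) (T : Finset (Fin n)) (y : Fin n → ℝ) (i : Fin n) : ℝ :=
  if i ∈ T then √(1 + τ) * (y i - factorCoeff τ T.card / √(1 + τ * T.card) * ∑ j ∈ T, y j)
  else y i

lemma measurable_factorInv : Measurable (factorInv τ T) := by
  refine measurable_pi_lambda _ fun i => ?_
  by_cases hi : i ∈ T <;> simp only [factorInv, hi, if_true, if_false] <;> fun_prop

lemma factorInv_factor_mulVec (hτ : 0 ≤ τ) (x : Fin n → ℝ) :
    factorInv τ T ((factor τ T).mulVec x) = x := by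
  have h1 : 0 < √(1 + τ) := Real.sqrt_pos.2 (by positivity)
  have h2 : 0 < √(1 + τ * T.card) := Real.sqrt_pos.2 (by positivity)
  have h3 := one_add_factorCoeff_mul hτ (Nat.cast_nonneg T.card)
  have hsum : ∑ j ∈ T, (factor τ T).mulVec x j =
      (√(1 + τ))⁻¹ * (√(1 + τ * T.card) * ∑ j ∈ T, x j) := by
    rw [← h3, Finset.sum_congr rfl fun j hj => by rw [factor_mulVec, if_pos hj],
      ← Finset.mul_sum, Finset.sum_add_distrib, Finset.sum_const, nsmul_eq_mul]
    ring
  ext i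
  rw [factorInv, hsum, factor_mulVec]
  by_cases hi : i ∈ T
  · simp only [hi, if_true]
    field_simp
    ring
  · simp [hi]

/-- The left side is the quadratic form of `I - Σ⁻¹`, the Gaussian exponent up to the factor `1/2`;
the right side is the Sherman–Morrison formula for `Σ⁻¹`. -/
lemma sum_sq_factorInv (hτ : 0 ≤ τ) (y : Fin n → ℝ) :
    ∑ i, y i ^ 2 - ∑ i, factorInv τ T y i ^ 2 =
      - τ * ∑ i ∈ T, y i ^ 2 + τ * (1 + τ) / (1 + τ * T.card) * (∑ i ∈ T, y i) ^ 2 := by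
  have h1 : √(1 + τ) ^ 2 = 1 + τ := Real.sq_sqrt (by positivity)
  have h2 : √(1 + τ * T.card) ^ 2 = 1 + τ * T.card := Real.sq_sqrt (by positivity)
  have h2' : 0 < √(1 + τ * T.card) := Real.sqrt_pos.2 (by positivity)
  have h3 := one_add_factorCoeff_mul hτ (Nat.cast_nonneg T.card)
  have h4 := factorCoeff_mul_one_add_sqrt τ T.card
  have hTc : ∑ i ∈ Tᶜ, factorInv τ T y i ^ 2 = ∑ i ∈ Tᶜ, y i ^ 2 :=
    Finset.sum_congr rfl fun i hi => by
      rw [factorInv, if_neg (Finset.mem_compl.1 hi)]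
  rw [← Finset.sum_add_sum_compl T, ← Finset.sum_add_sum_compl T fun i => factorInv τ T y i ^ 2,
    hTc, add_sub_add_right_eq_sub]
  set b := factorCoeff τ T.card
  set q := √(1 + τ * T.card)
  set s := ∑ i ∈ T, y i
  have hT : ∑ i ∈ T, factorInv τ T y i ^ 2 =
      (1 + τ) * (∑ i ∈ T, y i ^ 2 - 2 * (b / q * s) * s + T.card * (b / q * s) ^ 2) := by
    rw [Finset.sum_congr rfl fun i hi => show factorInv τ T y i ^ 2 =
      (1 + τ) * (y i ^ 2 - 2 * (b / q * s) * y i + (b / q * s) ^ 2) by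
        rw [factorInv, if_pos hi, mul_pow, h1]; ring]
    rw [← Finset.mul_sum, Finset.sum_add_distrib, Finset.sum_sub_distrib, ← Finset.mul_sum,
      Finset.sum_const, nsmul_eq_mul]
  -- With `c = b / q`, the square of `I - c 11ᵀ` is `I - (2c - s c²) 11ᵀ`, which must be the inverse
  -- of `I + τ 11ᵀ`.
  have hc : 2 * (b / q) - T.card * (b / q) ^ 2 = τ / (1 + τ * T.card) := by
    rw [← h2, ← h4]
    field_simp
    linear_combination (-b) * h3
  rw [hT, mul_div_right_comm, ← hc]
  ring

/-- The density of the law of one vector with respect to the standard Gaussian law. -/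
lemma map_ofLp_sampleLaw (hτ : 0 ≤ τ) :
    (sampleLaw (τ / (1 + τ)) T).map WithLp.ofLp =
      (Measure.pi fun _ : Fin n => gaussianReal 0 1).withDensity fun x =>
        ENNReal.ofReal (Real.exp (logRatio τ T x)) := by
  have hdet : (factor τ T).det ≠ 0 := by
    rw [factor_det T hτ]
    have h1 : 0 < √(1 + τ) := Real.sqrt_pos.2 (by positivity)
    have h2 : 0 < √(1 + τ * T.card) := Real.sqrt_pos.2 (by positivity)
    positivity
  have hmA : Measurable ((factor τ T).mulVec : (Fin n → ℝ) → Fin n → ℝ) :=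
    ((factor τ T).mulVecLin.continuous_of_finiteDimensional).measurable
  have h : sampleLaw (τ / (1 + τ)) T = (stdGaussian (EuclideanSpace ℝ (Fin n))).map
      (Matrix.toEuclideanCLM (𝕜 := ℝ) (factor τ T)) := by
    rw [← multivariateGaussian_zero_one,
      map_toEuclideanCLM_multivariateGaussian Matrix.PosSemidef.one, mul_one,
      factor_mul_transpose T hτ, sampleLaw]
  rw [h, ← map_pi_eq_stdGaussian, Measure.map_map (by fun_prop) (by fun_prop),
    Measure.map_map (by fun_prop) (by fun_prop)]
  have hcomp : (WithLp.ofLp ∘ (Matrix.toEuclideanCLM (𝕜 := ℝ) (factor τ T))) ∘ WithLp.toLp 2 =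
      (factor τ T).mulVec := by
    ext x i; simp
  rw [hcomp, map_mulVec_pi_gaussianReal _ hdet _ (measurable_factorInv T)
    (factorInv_factor_mulVec T hτ)]
  congr 1
  ext x
  rw [abs_det_factor_inv T hτ, ← Real.exp_add, sum_sq_factorInv T hτ, logRatio]
  congr 3
  ring

end Factor

/-! ### One observation under the null hypothesis and under an alternative -/

section Observation

variable {n : ℕ} {τ : ℝ}

lemma measurable_logRatio (T : Finset (Fin n)) : Measurable (logRatio τ T) := by
  unfold logRatio
  fun_prop

/-- The coordinates outside `a` are replaced by `0`. -/
def restrictTo (a : Finset (Fin n)) (x : Fin n → ℝ) : Fin n → ℝ :=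
  fun i => if i ∈ a then x i else 0

lemma measurable_restrictTo (a : Finset (Fin n)) : Measurable (restrictTo a) := by
  refine measurable_pi_lambda _ fun i => ?_
  by_cases hi : i ∈ a <;> simp only [restrictTo, hi, if_true, if_false] <;> fun_prop

lemma logRatio_restrictTo {a T : Finset (Fin n)} (h : T ⊆ a) (x : Fin n → ℝ) :
    logRatio τ T (restrictTo a x) = logRatio τ T x := by
  have h1 : ∑ i ∈ T, restrictTo a x i = ∑ i ∈ T, x i :=
    Finset.sum_congr rfl fun i hi => if_pos (h hi)
  have h2 : ∑ i ∈ T, restrictTo a x i ^ 2 = ∑ i ∈ T, x i ^ 2 :=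
    Finset.sum_congr rfl fun i hi => by rw [restrictTo, if_pos (h hi)]
  rw [logRatio, logRatio, h1, h2]

/-- Masking keeps only covariance entries with both indices in `a`, where `S` and `a ∩ S` agree. The
density can then be written in observed coordinates only. -/
lemma map_mask_sampleLaw_inter (hτ : 0 ≤ τ) (a S : Finset (Fin n)) :
    (sampleLaw (τ / (1 + τ)) S).map (mask a) =
      (sampleLaw (τ / (1 + τ)) (a ∩ S)).map (mask a) := by
  let D : Matrix (Fin n) (Fin n) ℝ := Matrix.diagonal fun i => if i ∈ a then 1 else 0
  have hmask : mask a = WithLp.ofLp ∘ Matrix.toEuclideanCLM (𝕜 := ℝ) D := by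
    ext u i
    simp [mask, D, Matrix.mulVec_diagonal]
  have hD : D * sigma (τ / (1 + τ)) S * D.transpose =
      D * sigma (τ / (1 + τ)) (a ∩ S) * D.transpose := by
    ext i j
    simp only [D, Matrix.diagonal_transpose, Matrix.mul_diagonal, Matrix.diagonal_mul, sigma,
      Matrix.of_apply, Finset.mem_inter]
    by_cases hi : i ∈ a <;> by_cases hj : j ∈ a <;> simp [hi, hj]
  rw [hmask, ← Measure.map_map (by fun_prop) (by fun_prop),
    ← Measure.map_map (by fun_prop) (by fun_prop), sampleLaw, sampleLaw,
    map_toEuclideanCLM_multivariateGaussian (sigma_posSemidef S hτ), hD,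
    ← map_toEuclideanCLM_multivariateGaussian (sigma_posSemidef (a ∩ S) hτ)]

lemma obsKernel_apply (ρ : ℝ) (S a : Finset (Fin n)) :
    obsKernel ρ S a = (sampleLaw ρ S).map (mask a) := rfl

lemma obsKernel_eq_map_withDensity (hτ : 0 ≤ τ) (a S : Finset (Fin n)) :
    obsKernel (τ / (1 + τ)) S a =
      ((Measure.pi fun _ : Fin n => gaussianReal 0 1).withDensity fun x =>
        ENNReal.ofReal (Real.exp (logRatio τ (a ∩ S) x))).map (restrictTo a) := by
  rw [obsKernel_apply, map_mask_sampleLaw_inter hτ, ← map_ofLp_sampleLaw _ hτ,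
    Measure.map_map (measurable_restrictTo a) (by fun_prop)]
  rfl

lemma obsKernel_empty (hτ : 0 ≤ τ) (a : Finset (Fin n)) :
    obsKernel (τ / (1 + τ)) ∅ a =
      (Measure.pi fun _ : Fin n => gaussianReal 0 1).map (restrictTo a) := by
  rw [obsKernel_eq_map_withDensity hτ]
  congr 1
  simp [logRatio]

/-- Change of measure from the null hypothesis to an alternative for one observation. -/
lemma lintegral_obsKernel (hτ : 0 ≤ τ) (a S : Finset (Fin n)) {f : (Fin n → ℝ) → ℝ≥0∞}
    (hf : Measurable f) :
    ∫⁻ x, f x ∂obsKernel (τ / (1 + τ)) S a =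
      ∫⁻ x, f x * ENNReal.ofReal (Real.exp (logRatio τ (a ∩ S) x))
        ∂obsKernel (τ / (1 + τ)) ∅ a := by
  have hm : Measurable fun x : Fin n → ℝ =>
      ENNReal.ofReal (Real.exp (logRatio τ (a ∩ S) x)) :=
    ((Real.measurable_exp.comp (measurable_logRatio _))).ennreal_ofReal
  have hfm : Measurable fun x =>
      f x * ENNReal.ofReal (Real.exp (logRatio τ (a ∩ S) x)) := hf.mul hm
  rw [obsKernel_eq_map_withDensity hτ, obsKernel_empty hτ,
    lintegral_map hf (measurable_restrictTo a), lintegral_map hfm (measurable_restrictTo a),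
    lintegral_withDensity_eq_lintegral_mul _ hm (g := fun x => f (restrictTo a x))
      (hf.comp (measurable_restrictTo a))]
  refine lintegral_congr fun x => ?_
  rw [logRatio_restrictTo Finset.inter_subset_left, Pi.mul_apply, mul_comm]

lemma memLp_eval_pi_gaussianReal (i : Fin n) :
    MemLp (fun x : Fin n → ℝ => x i) 2 (Measure.pi fun _ => gaussianReal 0 1) :=
  (memLp_id_gaussianReal 2).comp_measurePreserving (measurePreserving_eval _ i)

lemma memLp_sum_pi_gaussianReal (T : Finset (Fin n)) :
    MemLp (fun x : Fin n → ℝ => ∑ i ∈ T, x i) 2 (Measure.pi fun _ => gaussianReal 0 1) :=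
  memLp_finsetSum _ fun i _ => memLp_eval_pi_gaussianReal i

lemma integral_sq_sum_pi_gaussianReal (T : Finset (Fin n)) :
    ∫ x : Fin n → ℝ, (∑ i ∈ T, x i) ^ 2 ∂(Measure.pi fun _ => gaussianReal 0 1) = T.card := by
  have hmean : ∫ x : Fin n → ℝ, ∑ i ∈ T, x i ∂(Measure.pi fun _ => gaussianReal 0 1) = 0 := by
    rw [integral_finsetSum _ fun i _ => (memLp_eval_pi_gaussianReal i).integrable (by norm_num)]
    exact Finset.sum_eq_zero fun i _ => by simp [integral_eval]
  rw [← variance_of_integral_eq_zero (by fun_prop) hmean]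
  have h := variance_sum_pi (μ := fun _ : Fin n => gaussianReal 0 1)
    (X := fun i y => (if i ∈ T then 1 else 0) * id y)
    fun i => (memLp_id_gaussianReal 2).const_mul _
  have hX : (∑ i, fun ω : Fin n → ℝ => (if i ∈ T then 1 else 0) * id (ω i)) =
      fun x => ∑ i ∈ T, x i := by
    ext x
    simp [Finset.sum_apply]
  rw [hX] at h
  rw [h]
  simp_rw [variance_const_mul, variance_id_gaussianReal]
  simp

lemma integrable_logRatio (T : Finset (Fin n)) :
    Integrable (logRatio τ T) (Measure.pi fun _ => gaussianReal 0 1) := by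
  unfold logRatio
  refine Integrable.div_const (Integrable.add (Integrable.sub (integrable_const _)
    (Integrable.const_mul (integrable_finsetSum _ fun i _ => ?_) _)) (Integrable.const_mul ?_ _)) _
  · exact (memLp_eval_pi_gaussianReal i).integrable_sq
  · exact (memLp_sum_pi_gaussianReal T).integrable_sq

/-- The Kullback–Leibler divergence of one observation is at most quadratic in the number of
contaminated coordinates that are seen. -/
lemma neg_le_integral_logRatio (hτ : 0 ≤ τ) (T : Finset (Fin n)) :
    - (τ ^ 2 * T.card ^ 2 / 2) ≤
      ∫ x, logRatio τ T x ∂(Measure.pi fun _ => gaussianReal 0 1) := by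
  have hi1 : Integrable (fun x : Fin n → ℝ => ∑ i ∈ T, x i ^ 2)
      (Measure.pi fun _ => gaussianReal 0 1) :=
    integrable_finsetSum _ fun i _ => (memLp_eval_pi_gaussianReal i).integrable_sq
  have hi2 := (memLp_sum_pi_gaussianReal T).integrable_sq
  have h1 : ∫ x : Fin n → ℝ, ∑ i ∈ T, x i ^ 2 ∂(Measure.pi fun _ => gaussianReal 0 1)
      = T.card := by
    rw [integral_finsetSum _ fun i _ => (memLp_eval_pi_gaussianReal i).integrable_sq]
    have (i : Fin n) : ∫ x : Fin n → ℝ, x i ^ 2 ∂(Measure.pi fun _ => gaussianReal 0 1) = 1 := by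
      simpa using integral_sq_sum_pi_gaussianReal {i}
    simp [this]
  have hmean : ∫ x, logRatio τ T x ∂(Measure.pi fun _ => gaussianReal 0 1) =
      (T.card * Real.log (1 + τ) - Real.log (1 + τ * T.card) - τ * T.card
        + τ * (1 + τ) / (1 + τ * T.card) * T.card) / 2 := by
    unfold logRatio
    have hi3 (u : ℝ) : Integrable (fun x : Fin n → ℝ => u - τ * ∑ i ∈ T, x i ^ 2)
        (Measure.pi fun _ => gaussianReal 0 1) := (integrable_const _).sub (hi1.const_mul _)
    rw [integral_div, integral_add (hi3 _) (hi2.const_mul _),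
      integral_sub (integrable_const _) (hi1.const_mul _), integral_const, integral_const_mul,
      integral_const_mul, h1, integral_sq_sum_pi_gaussianReal]
    simp
  -- Bernoulli's inequality: the logarithmic terms contribute a nonnegative amount and may be
  -- dropped.
  have hlog : Real.log (1 + τ * T.card) ≤ T.card * Real.log (1 + τ) := by
    rw [← Real.log_pow]
    refine Real.log_le_log (by positivity) ?_
    rw [mul_comm]
    exact one_add_mul_le_pow (by linarith) _
  have hquad : - (τ ^ 2 * T.card ^ 2) ≤
      - (τ * T.card) + τ * (1 + τ) / (1 + τ * T.card) * T.card := by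
    have hs : (0 : ℝ) ≤ T.card := Nat.cast_nonneg _
    have hpos : (0 : ℝ) < 1 + τ * T.card := by positivity
    have : - (τ * T.card) + τ * (1 + τ) / (1 + τ * T.card) * T.card + τ ^ 2 * T.card ^ 2 =
        (τ ^ 2 * T.card + τ ^ 3 * T.card ^ 3) / (1 + τ * T.card) := by
      field_simp
      ring
    have h0 : 0 ≤ (τ ^ 2 * T.card + τ ^ 3 * T.card ^ 3) / (1 + τ * T.card) := by positivity
    linarith
  rw [hmean]
  linarith

lemma integrable_logRatio_obsKernel (hτ : 0 ≤ τ) (a S : Finset (Fin n)) :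
    Integrable (logRatio τ (a ∩ S)) (obsKernel (τ / (1 + τ)) ∅ a) := by
  rw [obsKernel_empty hτ, integrable_map_measure (measurable_logRatio _).aestronglyMeasurable
    (measurable_restrictTo a).aemeasurable]
  refine (integrable_logRatio (τ := τ) (a ∩ S)).congr (ae_of_all _ fun x => ?_)
  exact (logRatio_restrictTo Finset.inter_subset_left x).symm

lemma neg_le_integral_logRatio_obsKernel (hτ : 0 ≤ τ) (a S : Finset (Fin n)) :
    - (τ ^ 2 * (a ∩ S).card ^ 2 / 2) ≤
      ∫ x, logRatio τ (a ∩ S) x ∂obsKernel (τ / (1 + τ)) ∅ a := by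
  rw [obsKernel_empty hτ, integral_map (measurable_restrictTo a).aemeasurable
    (measurable_logRatio _).aestronglyMeasurable]
  simp_rw [logRatio_restrictTo (Finset.inter_subset_left (s₁ := a) (s₂ := S))]
  exact neg_le_integral_logRatio hτ _

end Observation

/-! ### The likelihood ratio of a history -/

section History

variable {n : ℕ} {τ : ℝ} (S : Finset (Fin n))

/-- The log-likelihood ratio of one round. -/
def roundLogRatio (τ : ℝ) (r : Round n) : ℝ := logRatio τ (r.1 ∩ S) r.2

/-- The bound on the divergence of one round. -/
def roundCost (τ : ℝ) (r : Round n) : ℝ := τ ^ 2 * (r.1 ∩ S).card ^ 2 / 2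

/-- The log-likelihood ratio of a history. -/
def historyLogRatio (τ : ℝ) {t : ℕ} (h : History n t) : ℝ := ∑ s, roundLogRatio S τ (h s)

/-- The bound on the divergence of a history. -/
def historyCost (τ : ℝ) {t : ℕ} (h : History n t) : ℝ := ∑ s, roundCost S τ (h s)

lemma measurable_roundLogRatio : Measurable (roundLogRatio S τ) :=
  measurable_from_prod_countable_right fun a => measurable_logRatio (a ∩ S)

lemma measurable_roundCost : Measurable (roundCost S τ) :=
  by
  unfold roundCost
  exact measurable_from_prod_countable_right fun a =>
    measurable_const (a := τ ^ 2 * ((a ∩ S).card : ℝ) ^ 2 / 2)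

lemma measurable_historyLogRatio {t : ℕ} :
    Measurable (historyLogRatio S τ : History n t → ℝ) :=
  Finset.measurable_sum _ fun s _ =>
    (measurable_roundLogRatio S).comp (measurable_pi_apply s)

lemma historyLogRatio_snoc {t : ℕ} (h : History n t) (r : Round n) :
    historyLogRatio S τ (Fin.snoc (α := fun _ => Round n) h r : History n (t + 1)) =
      historyLogRatio S τ h + roundLogRatio S τ r := by
  simp [historyLogRatio, Fin.sum_univ_castSucc]

variable (𝒜 : SensingStrategy n)

lemma lintegral_roundKernel (ρ : ℝ) (t : ℕ) (h : History n t) {f : Round n → ℝ≥0∞}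
    (hf : Measurable f) :
    ∫⁻ r, f r ∂𝒜.roundKernel ρ S t h =
      ∫⁻ a, ∫⁻ x, f (a, x) ∂obsKernel ρ S a ∂𝒜.query t h := by
  have := 𝒜.isMarkov t
  rw [SensingStrategy.roundKernel, Kernel.lintegral_compProd _ _ _ hf]
  rfl

/-- Change of measure from the null hypothesis to an alternative for one round. -/
lemma lintegral_roundKernel_eq (hτ : 0 ≤ τ) (t : ℕ) (h : History n t) {f : Round n → ℝ≥0∞}
    (hf : Measurable f) :
    ∫⁻ r, f r ∂𝒜.roundKernel (τ / (1 + τ)) S t h =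
      ∫⁻ r, f r * ENNReal.ofReal (Real.exp (roundLogRatio S τ r))
        ∂𝒜.roundKernel (τ / (1 + τ)) ∅ t h := by
  have hfr : Measurable fun r => f r * ENNReal.ofReal (Real.exp (roundLogRatio S τ r)) :=
    hf.mul (measurable_roundLogRatio S).exp.ennreal_ofReal
  rw [lintegral_roundKernel _ _ _ _ _ hf, lintegral_roundKernel _ _ _ _ _ hfr]
  -- The query law is common to both sides, so only the observation contributes to the ratio.
  refine lintegral_congr fun a => ?_
  exact lintegral_obsKernel hτ a S (hf.comp measurable_prodMk_left)

lemma lintegral_law_succ (ρ : ℝ) (t : ℕ) {f : History n (t + 1) → ℝ≥0∞} (hf : Measurable f) :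
    ∫⁻ h, f h ∂𝒜.law ρ S (t + 1) =
      ∫⁻ h, ∫⁻ r, f (Fin.snoc (α := fun _ => Round n) h r) ∂𝒜.roundKernel ρ S t h
        ∂𝒜.law ρ S t := by
  rw [SensingStrategy.law, lintegral_map hf (SensingStrategy.measurable_snoc t)]
  exact Measure.lintegral_compProd (hf.comp (SensingStrategy.measurable_snoc t))

/-- Change of measure from the null hypothesis to an alternative. -/
lemma lintegral_law (hτ : 0 ≤ τ) (t : ℕ) {f : History n t → ℝ≥0∞} (hf : Measurable f) :
    ∫⁻ h, f h ∂𝒜.law (τ / (1 + τ)) S t =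
      ∫⁻ h, f h * ENNReal.ofReal (Real.exp (historyLogRatio S τ h))
        ∂𝒜.law (τ / (1 + τ)) ∅ t := by
  induction t with
  | zero => simp [SensingStrategy.law, historyLogRatio]
  | succ t ih =>
    have hs := SensingStrategy.measurable_snoc (n := n) t
    have hr := (measurable_roundLogRatio S (τ := τ)).exp.ennreal_ofReal
    have hfr : Measurable fun p : History n t × Round n =>
        f (Fin.snoc (α := fun _ => Round n) p.1 p.2) *
          ENNReal.ofReal (Real.exp (roundLogRatio S τ p.2)) :=
      (hf.comp hs).mul (hr.comp measurable_snd)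
    have hfh : Measurable fun h : History n (t + 1) =>
        f h * ENNReal.ofReal (Real.exp (historyLogRatio S τ h)) :=
      hf.mul (measurable_historyLogRatio S).exp.ennreal_ofReal
    rw [lintegral_law_succ _ _ _ _ hf, lintegral_law_succ _ _ _ _ hfh]
    have h1 (h : History n t) := lintegral_roundKernel_eq S 𝒜 hτ t h
      (f := fun r => f (Fin.snoc (α := fun _ => Round n) h r))
      (hf.comp (hs.comp measurable_prodMk_left))
    simp_rw [h1]
    -- The induction hypothesis is applied to the function of the past left after integrating out
    -- the last round, already weighted by that round's ratio.
    rw [ih hfr.lintegral_kernel_prod_right']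
    refine lintegral_congr fun h => ?_
    have hfrh : Measurable fun r : Round n => f (Fin.snoc (α := fun _ => Round n) h r) *
        ENNReal.ofReal (Real.exp (roundLogRatio S τ r)) := hfr.comp measurable_prodMk_left
    rw [mul_comm, ← lintegral_const_mul _ hfrh]
    refine lintegral_congr fun r => ?_
    rw [historyLogRatio_snoc, Real.exp_add, ENNReal.ofReal_mul (Real.exp_nonneg _)]
    ring

lemma integrable_roundLogRatio_add_roundCost_obsKernel (hτ : 0 ≤ τ) (a : Finset (Fin n)) :
    Integrable (fun x => roundLogRatio S τ (a, x) + roundCost S τ (a, x))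
      (obsKernel (τ / (1 + τ)) ∅ a) := by
  exact (integrable_logRatio_obsKernel hτ a S).add
    (integrable_const (τ ^ 2 * ((a ∩ S).card : ℝ) ^ 2 / 2))

lemma integral_roundLogRatio_add_roundCost_obsKernel_nonneg (hτ : 0 ≤ τ) (a : Finset (Fin n)) :
    0 ≤ ∫ x, roundLogRatio S τ (a, x) + roundCost S τ (a, x) ∂obsKernel (τ / (1 + τ)) ∅ a := by
  have h := neg_le_integral_logRatio_obsKernel hτ a S
  simp only [roundLogRatio, roundCost]
  rw [integral_add (integrable_logRatio_obsKernel hτ a S) (integrable_const _), integral_const]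
  simp only [probReal_univ, one_smul]
  linarith

/-- The expected absolute value of the log-likelihood ratio of a round is bounded uniformly in the
history. -/
lemma lintegral_enorm_roundKernel_le (t : ℕ) (h : History n t) (ρ : ℝ) {f : Round n → ℝ}
    (hf : Measurable f) :
    ∫⁻ r, ‖f r‖ₑ ∂𝒜.roundKernel ρ ∅ t h ≤
      ∑ a : Finset (Fin n), ∫⁻ x, ‖f (a, x)‖ₑ ∂obsKernel ρ ∅ a := by
  have := 𝒜.isMarkov t
  rw [lintegral_roundKernel _ _ _ _ _ hf.enorm]
  calc ∫⁻ a, ∫⁻ x, ‖f (a, x)‖ₑ ∂obsKernel ρ ∅ a ∂𝒜.query t h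
      ≤ ∫⁻ _, ∑ a : Finset (Fin n), ∫⁻ x, ‖f (a, x)‖ₑ ∂obsKernel ρ ∅ a ∂𝒜.query t h :=
        lintegral_mono fun a => Finset.single_le_sum
          (f := fun a => ∫⁻ x, ‖f (a, x)‖ₑ ∂obsKernel ρ ∅ a) (fun _ _ => zero_le)
          (Finset.mem_univ a)
    _ = _ := by simp

/-- A tower-property argument: nonnegativity given each query passes to each round and then to the
sum. There are finitely many queries, so the first absolute moment of a round is bounded uniformly
over histories, which gives integrability. It is used with `f` the log-ratio plus the cost of a
round. -/
lemma integrable_and_integral_nonneg_law {ρ : ℝ} {f : Round n → ℝ} (hf : Measurable f)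
    (hint : ∀ a, Integrable (fun x => f (a, x)) (obsKernel ρ ∅ a))
    (hnn : ∀ a, 0 ≤ ∫ x, f (a, x) ∂obsKernel ρ ∅ a) (t : ℕ) :
    Integrable (fun h : History n t => ∑ s, f (h s)) (𝒜.law ρ ∅ t) ∧
      0 ≤ ∫ h : History n t, ∑ s, f (h s) ∂𝒜.law ρ ∅ t := by
  have hfin : ∑ a : Finset (Fin n), ∫⁻ x, ‖f (a, x)‖ₑ ∂obsKernel ρ ∅ a < ∞ :=
    ENNReal.sum_lt_top.2 fun a _ => (hint a).2
  have hround (t : ℕ) (h : History n t) : Integrable f (𝒜.roundKernel ρ ∅ t h) :=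
    ⟨hf.aestronglyMeasurable, (lintegral_enorm_roundKernel_le 𝒜 t h ρ hf).trans_lt hfin⟩
  have hroundnn (t : ℕ) (h : History n t) : 0 ≤ ∫ r, f r ∂𝒜.roundKernel ρ ∅ t h := by
    have := 𝒜.isMarkov t
    have h1 := hround t h
    rw [SensingStrategy.roundKernel] at h1 ⊢
    rw [ProbabilityTheory.integral_compProd h1]
    exact integral_nonneg fun a => hnn a
  induction t with
  | zero => simp
  | succ t ih =>
    have hs := SensingStrategy.measurable_snoc (n := n) t
    have hsum (m : ℕ) : Measurable fun h : History n m => ∑ s, f (h s) :=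
      Finset.measurable_sum _ fun s _ => hf.comp (measurable_pi_apply s)
    have hi1 : Integrable (fun p : History n t × Round n => ∑ s, f (p.1 s))
        (𝒜.law ρ ∅ t ⊗ₘ 𝒜.roundKernel ρ ∅ t) := by
      have := ih.1
      rw [← Measure.fst_compProd (𝒜.law ρ ∅ t) (𝒜.roundKernel ρ ∅ t), Measure.fst,
        integrable_map_measure (hsum t).aestronglyMeasurable (by fun_prop)] at this
      exact this
    have hi2 : Integrable (fun p : History n t × Round n => f p.2)
        (𝒜.law ρ ∅ t ⊗ₘ 𝒜.roundKernel ρ ∅ t) := by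
      refine ⟨(hf.comp measurable_snd).aestronglyMeasurable, ?_⟩
      have hfs : Measurable fun p : History n t × Round n => ‖f p.2‖ₑ :=
        (hf.comp measurable_snd).enorm
      rw [HasFiniteIntegral, Measure.lintegral_compProd hfs]
      refine (lintegral_mono fun h => lintegral_enorm_roundKernel_le 𝒜 t h ρ hf).trans_lt ?_
      simpa using hfin
    have heq : (fun h : History n (t + 1) => ∑ s, f (h s)) ∘
        (fun p : History n t × Round n => Fin.snoc (α := fun _ => Round n) p.1 p.2) =
        fun p => ∑ s, f (p.1 s) + f p.2 := by
      ext p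
      simp [Fin.sum_univ_castSucc]
    rw [SensingStrategy.law, integrable_map_measure (hsum _).aestronglyMeasurable hs.aemeasurable,
      integral_map hs.aemeasurable (hsum _).aestronglyMeasurable]
    refine ⟨heq ▸ hi1.add hi2, ?_⟩
    change 0 ≤ ∫ p, ((fun h : History n (t + 1) => ∑ s, f (h s)) ∘
        (fun p : History n t × Round n => Fin.snoc (α := fun _ => Round n) p.1 p.2)) p ∂_
    rw [heq, integral_add hi1 hi2, Measure.integral_compProd hi1, Measure.integral_compProd hi2]
    refine add_nonneg ?_ (integral_nonneg fun h => hroundnn t h)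
    simpa using ih.2

lemma roundCost_le (r : Round n) : roundCost S τ r ≤ τ ^ 2 * n ^ 2 / 2 := by
  have : ((r.1 ∩ S).card : ℝ) ≤ n := by
    exact_mod_cast (Finset.card_le_univ _).trans_eq (Fintype.card_fin n)
  unfold roundCost
  gcongr

lemma roundCost_nonneg (r : Round n) : 0 ≤ roundCost S τ r := by
  unfold roundCost
  positivity

lemma integrable_historyCost (ρ : ℝ) (t : ℕ) :
    Integrable (historyCost S τ : History n t → ℝ) (𝒜.law ρ ∅ t) := by
  refine integrable_finsetSum _ fun s _ => Integrable.of_bound (C := τ ^ 2 * n ^ 2 / 2)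
    ((measurable_roundCost S).comp (measurable_pi_apply s)).aestronglyMeasurable
    (ae_of_all _ fun h => ?_)
  rw [Real.norm_of_nonneg (roundCost_nonneg _ _)]
  exact roundCost_le _ _

lemma integrable_historyLogRatio (hτ : 0 ≤ τ) (t : ℕ) :
    Integrable (historyLogRatio S τ : History n t → ℝ) (𝒜.law (τ / (1 + τ)) ∅ t) := by
  have h := (integrable_and_integral_nonneg_law 𝒜
    ((measurable_roundLogRatio S).add (measurable_roundCost S))
    (integrable_roundLogRatio_add_roundCost_obsKernel S hτ)
    (integral_roundLogRatio_add_roundCost_obsKernel_nonneg S hτ) t).1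
  refine (h.sub (integrable_historyCost S (τ := τ) 𝒜 _ t)).congr (ae_of_all _ fun x => ?_)
  simp [historyLogRatio, historyCost, Finset.sum_add_distrib]

/-- The divergence of the null law from an alternative is at most the expected cost. -/
lemma neg_integral_historyCost_le (hτ : 0 ≤ τ) (t : ℕ) :
    - ∫ h : History n t, historyCost S τ h ∂𝒜.law (τ / (1 + τ)) ∅ t ≤
      ∫ h : History n t, historyLogRatio S τ h ∂𝒜.law (τ / (1 + τ)) ∅ t := by
  have h := (integrable_and_integral_nonneg_law 𝒜
    ((measurable_roundLogRatio S).add (measurable_roundCost S))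
    (integrable_roundLogRatio_add_roundCost_obsKernel S hτ)
    (integral_roundLogRatio_add_roundCost_obsKernel_nonneg S hτ) t).2
  have h2 : ∫ h : History n t, historyLogRatio S τ h + historyCost S τ h
      ∂𝒜.law (τ / (1 + τ)) ∅ t = _ :=
    integral_add (integrable_historyLogRatio S 𝒜 hτ t) (integrable_historyCost S 𝒜 _ t)
  simp only [Pi.add_apply, Finset.sum_add_distrib] at h
  simp only [historyLogRatio, historyCost] at h2 ⊢
  linarith

/-- A lower bound for the error of the second kind under one alternative. -/
lemma le_real_law_compl (hτ : 0 ≤ τ) (t : ℕ) {E : Set (History n t)} (hE : MeasurableSet E)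
    (θ : ℝ) :
    Real.exp (-θ) * ((𝒜.law (τ / (1 + τ)) ∅ t).real Eᶜ * (1 + θ) - 1 -
        ∫ h, historyCost S τ h ∂𝒜.law (τ / (1 + τ)) ∅ t) ≤
      (𝒜.law (τ / (1 + τ)) S t).real Eᶜ := by
  set P := 𝒜.law (τ / (1 + τ)) ∅ t
  set Q := 𝒜.law (τ / (1 + τ)) S t
  set Λ : History n t → ℝ := historyLogRatio S τ
  have hΛm : Measurable Λ := measurable_historyLogRatio S
  have hdens : Q = P.withDensity fun h => ENNReal.ofReal (Real.exp (Λ h)) := by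
    refine Measure.ext_of_lintegral _ fun f hf => ?_
    rw [lintegral_law S 𝒜 hτ t hf, lintegral_withDensity_eq_lintegral_mul _
      hΛm.exp.ennreal_ofReal hf]
    simp only [Pi.mul_apply, mul_comm]
    rfl
  have hexp : Integrable (fun h => Real.exp (Λ h)) P := by
    refine ⟨hΛm.exp.aestronglyMeasurable, ?_⟩
    have h1 : ∫⁻ h, ENNReal.ofReal (Real.exp (Λ h)) ∂P = 1 := by
      rw [← measure_univ (μ := Q), hdens, withDensity_apply _ MeasurableSet.univ,
        Measure.restrict_univ]
    rw [HasFiniteIntegral]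
    simp only [Real.enorm_of_nonneg (Real.exp_nonneg _), h1, ENNReal.one_lt_top]
  have hset {A : Set (History n t)} (hA : MeasurableSet A) :
      Q.real A = ∫ h in A, Real.exp (Λ h) ∂P := by
    rw [measureReal_def, hdens, withDensity_apply _ hA,
      integral_eq_lintegral_of_nonneg_ae (ae_of_all _ fun h => Real.exp_nonneg _)
        hΛm.exp.aestronglyMeasurable]
  have hΛi : Integrable Λ P := integrable_historyLogRatio S 𝒜 hτ t
  have hsplit := integral_add_compl hE hΛi
  -- On `E`, `Λ ≤ e^Λ`, and the integral of `e^Λ` there is `Q(E) ≤ 1`.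
  have hEle : ∫ h in E, Λ h ∂P ≤ 1 := by
    calc ∫ h in E, Λ h ∂P ≤ ∫ h in E, Real.exp (Λ h) ∂P :=
          integral_mono hΛi.restrict hexp.restrict fun h => by
            linarith [Real.add_one_le_exp (Λ h)]
      _ = Q.real E := (hset hE).symm
      _ ≤ 1 := measureReal_le_one
  -- On `Eᶜ`, `e^Λ` is bounded below by its tangent line at `Λ = -θ`.
  have hcompl : Real.exp (-θ) * (∫ h in Eᶜ, Λ h ∂P + P.real Eᶜ * (1 + θ)) ≤ Q.real Eᶜ := by
    rw [hset hE.compl]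
    have : ∫ h in Eᶜ, Real.exp (-θ) * (Λ h + (1 + θ)) ∂P =
        Real.exp (-θ) * (∫ h in Eᶜ, Λ h ∂P + P.real Eᶜ * (1 + θ)) := by
      rw [integral_const_mul, integral_add hΛi.restrict (integrable_const _), setIntegral_const,
        smul_eq_mul]
    rw [← this]
    refine integral_mono ((hΛi.restrict.add (integrable_const _)).const_mul _) hexp.restrict
      fun h => ?_
    have h1 := Real.add_one_le_exp (Λ h + θ)
    calc Real.exp (-θ) * (Λ h + (1 + θ)) ≤ Real.exp (-θ) * Real.exp (Λ h + θ) := by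
          gcongr; linarith
      _ = Real.exp (Λ h) := by rw [← Real.exp_add]; ring_nf
  have hcost := neg_integral_historyCost_le S 𝒜 hτ t
  refine le_trans (mul_le_mul_of_nonneg_left ?_ (Real.exp_nonneg _)) hcompl
  linarith

end History

/-! ### Disjoint intervals -/

section Blocks

variable {n k : ℕ}

/-- The block `{j k, …, (j + 1) k - 1}`. -/
def block (n k j : ℕ) : Finset (Fin n) :=
  Finset.univ.filter fun i : Fin n => j * k ≤ i.val ∧ i.val < (j + 1) * k

lemma map_block_subset (j : ℕ) :
    (block n k j).map Fin.valEmbedding ⊆ Finset.Ico (j * k) ((j + 1) * k) := by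
  intro x hx
  simp only [block, Finset.mem_map, Finset.mem_filter, Fin.valEmbedding_apply] at hx
  obtain ⟨i, hi, rfl⟩ := hx
  exact Finset.mem_Ico.2 hi.2

lemma card_block_le (j : ℕ) : (block n k j).card ≤ k := by
  have h := Finset.card_le_card (map_block_subset (n := n) (k := k) j)
  rw [Finset.card_map, Nat.card_Ico, add_mul, one_mul] at h
  omega

lemma add_one_mul_le_of_lt_div {j : ℕ} (hj : j < n / k) : (j + 1) * k ≤ n :=
  (Nat.mul_le_mul_right k hj).trans (Nat.div_mul_le_self n k)

lemma card_block {j : ℕ} (hj : j < n / k) : (block n k j).card = k := by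
  have h : (block n k j).map Fin.valEmbedding = Finset.Ico (j * k) ((j + 1) * k) := by
    refine (map_block_subset j).antisymm fun x hx => ?_
    rw [Finset.mem_Ico] at hx
    simp only [block, Finset.mem_map, Finset.mem_filter, Fin.valEmbedding_apply]
    exact ⟨⟨x, hx.2.trans_le (add_one_mul_le_of_lt_div hj)⟩, ⟨Finset.mem_univ _, hx⟩, rfl⟩
  rw [← Finset.card_map Fin.valEmbedding, h, Nat.card_Ico, add_mul, one_mul]
  omega

lemma disjoint_block {i j : ℕ} (h : i ≠ j) : Disjoint (block n k i) (block n k j) := by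
  refine Finset.disjoint_left.2 fun x hi hj => h ?_
  simp only [block, Finset.mem_filter] at hi hj
  rw [← Nat.div_eq_of_lt_le hi.2.1 hi.2.2, Nat.div_eq_of_lt_le hj.2.1 hj.2.2]

lemma disjointKIntervals_subset_kSets : disjointKIntervals n k ⊆ kSets n k := by
  rintro S ⟨j, hj, rfl⟩
  exact card_block hj

lemma disjointKIntervals_subset_kIntervals : disjointKIntervals n k ⊆ kIntervals n k := by
  rintro S ⟨j, hj, rfl⟩
  have h := add_one_mul_le_of_lt_div hj
  rw [add_mul, one_mul] at h
  exact ⟨j * k, h, by simp only [add_mul, one_mul]⟩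

lemma sum_card_inter_block_le (N : ℕ) (a : Finset (Fin n)) :
    ∑ j ∈ Finset.range N, (a ∩ block n k j).card ≤ a.card := by
  rw [← Finset.card_biUnion fun i _ j _ hij =>
    (disjoint_block hij).mono Finset.inter_subset_right Finset.inter_subset_right]
  exact Finset.card_le_card (Finset.biUnion_subset.2 fun j _ => Finset.inter_subset_left)

/-- One factor of `|a ∩ B_j|²` is at most `k`; the other factors sum to at most `|a|` by
disjointness. -/
lemma sum_roundCost_block_le (N : ℕ) (τ : ℝ) (r : Round n) :
    ∑ j ∈ Finset.range N, roundCost (block n k j) τ r ≤ τ ^ 2 * k * r.1.card / 2 := by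
  have h1 : ∑ j ∈ Finset.range N, ((r.1 ∩ block n k j).card : ℝ) ^ 2 ≤ k * r.1.card := by
    calc ∑ j ∈ Finset.range N, ((r.1 ∩ block n k j).card : ℝ) ^ 2
        ≤ ∑ j ∈ Finset.range N, (k : ℝ) * (r.1 ∩ block n k j).card := by
          refine Finset.sum_le_sum fun j _ => ?_
          have : ((r.1 ∩ block n k j).card : ℝ) ≤ k := by
            exact_mod_cast (Finset.card_le_card Finset.inter_subset_right).trans (card_block_le j)
          rw [sq]
          gcongr
      _ = k * ((∑ j ∈ Finset.range N, (r.1 ∩ block n k j).card : ℕ) : ℝ) := by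
          rw [← Finset.mul_sum, Nat.cast_sum]
      _ ≤ k * r.1.card := by
          gcongr
          exact sum_card_inter_block_le N r.1
  simp only [roundCost]
  rw [← Finset.sum_div, ← Finset.mul_sum, mul_assoc]
  gcongr

lemma sum_historyCost_block_le (N : ℕ) (τ : ℝ) {t : ℕ} (h : History n t) :
    ∑ j ∈ Finset.range N, historyCost (block n k j) τ h ≤ τ ^ 2 * k * spent h / 2 := by
  simp only [historyCost]
  rw [Finset.sum_comm]
  calc ∑ s, ∑ j ∈ Finset.range N, roundCost (block n k j) τ (h s)
      ≤ ∑ s, τ ^ 2 * k * ((h s).1.card : ℝ) / 2 :=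
        Finset.sum_le_sum fun s _ => sum_roundCost_block_le N τ (h s)
    _ = τ ^ 2 * k * spent h / 2 := by
        rw [spent, ← Finset.sum_div, ← Finset.mul_sum, Nat.cast_sum]

/-- The sum over the blocks of the expected costs is controlled by the budget. -/
lemma sum_integral_historyCost_block_le (N : ℕ) (ρ τ : ℝ) (M : ℕ) (𝒜 : SensingStrategy n)
    (hB : ∀ᵐ h ∂𝒜.law ρ ∅ M, spent h ≤ M) :
    ∑ j ∈ Finset.range N, ∫ h : History n M, historyCost (block n k j) τ h ∂𝒜.law ρ ∅ M ≤
      τ ^ 2 * k * M / 2 := by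
  rw [← integral_finsetSum _ fun j _ => integrable_historyCost _ 𝒜 ρ M]
  calc ∫ h : History n M, ∑ j ∈ Finset.range N, historyCost (block n k j) τ h ∂𝒜.law ρ ∅ M
      ≤ ∫ _ : History n M, τ ^ 2 * k * M / 2 ∂𝒜.law ρ ∅ M := by
        refine integral_mono_ae (integrable_finsetSum _ fun j _ => integrable_historyCost _ 𝒜 ρ M)
          (integrable_const _) ?_
        filter_upwards [hB] with h hh
        refine (sum_historyCost_block_le N τ h).trans ?_
        gcongr
    _ = τ ^ 2 * k * M / 2 := by simp

/-! ### The lower bound for the minimax risk -/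

/-- Either the type I error exceeds `1/2`, or the null acceptance probability is at least `1/2` and
averaging over blocks finds one with a large type II error. The budget matters only under the null,
where the costs are integrated. -/
lemma le_risk {τ : ℝ} (hτ : 0 ≤ τ) (hk : 1 ≤ k) (hkn : k ≤ n) {C : Set (Finset (Fin n))}
    (hC : disjointKIntervals n k ⊆ C) (M : ℕ) (𝒜 : SensingStrategy n)
    (hB : ∀ᵐ h ∂𝒜.law (τ / (1 + τ)) ∅ M, spent h ≤ M)
    {φ : History n M → Bool} (hφ : Measurable φ) :
    ENNReal.ofReal (Real.exp (-(2 * (τ ^ 2 * k ^ 2 * M / n) + 2)) / 2) ≤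
      risk (τ / (1 + τ)) C M 𝒜 φ := by
  set K : ℝ := τ ^ 2 * k ^ 2 * M / n with hK
  have hK0 : 0 ≤ K := by positivity
  set E : Set (History n M) := {h | φ h ≠ false}
  have hE : MeasurableSet E := hφ (MeasurableSet.of_discrete (s := {b | b ≠ false}))
  have hEc : {h | φ h ≠ true} = Eᶜ := by
    ext h
    simp [E]
  set P := 𝒜.law (τ / (1 + τ)) ∅ M with hP
  rw [risk, hEc, ← hP]
  rcases le_or_gt (1 / 2) (P.real Eᶜ) with hp | hp
  · refine le_add_left ?_
    set N := n / k with hN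
    have hNpos : 0 < N := Nat.div_pos hkn hk
    -- Rounding in `⌊n/k⌋` costs at most a factor 2, because `N ≥ 1`; this absorbs the `1/2` in the
    -- cost.
    have hnN : (n : ℝ) ≤ 2 * k * N := by
      have h1 : n < k * N + k := by
        rw [hN]
        have := Nat.div_add_mod n k
        have := Nat.mod_lt n hk
        omega
      have h2 : k ≤ k * N := Nat.le_mul_of_pos_right k hNpos
      have h3 : n ≤ 2 * k * N := by
        rw [mul_assoc]
        omega
      exact_mod_cast h3
    have hcost : ∑ j ∈ Finset.range N,
        ∫ h : History n M, historyCost (block n k j) τ h ∂P ≤ N * K := by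
      refine (sum_integral_historyCost_block_le N _ τ M 𝒜 hB).trans ?_
      have hn0 : (0 : ℝ) < n := by exact_mod_cast hk.trans hkn
      rw [hK, ← mul_div_assoc, le_div_iff₀ hn0]
      calc τ ^ 2 * k * M / 2 * n ≤ τ ^ 2 * k * M / 2 * (2 * k * N) := by gcongr
        _ = N * (τ ^ 2 * k ^ 2 * M) := by ring
    have hsum : ∑ _j ∈ Finset.range N, Real.exp (-(2 * K + 2)) / 2 ≤
        ∑ j ∈ Finset.range N, (𝒜.law (τ / (1 + τ)) (block n k j) M).real Eᶜ := by
      -- The level is `θ = 2K + 2`: with acceptance probability at least `1/2` and average cost at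
      -- most `K`, the bracket averages to at least `(3 + 2K)/2 - 1 - K = 1/2`.
      calc ∑ _j ∈ Finset.range N, Real.exp (-(2 * K + 2)) / 2
          = Real.exp (-(2 * K + 2)) * (N * (1 / 2 * (1 + (2 * K + 2)) - 1) - N * K) := by
            rw [Finset.sum_const, Finset.card_range, nsmul_eq_mul]
            ring
        _ ≤ Real.exp (-(2 * K + 2)) * (N * (P.real Eᶜ * (1 + (2 * K + 2)) - 1) -
              ∑ j ∈ Finset.range N, ∫ h : History n M, historyCost (block n k j) τ h ∂P) := by
            gcongr
        _ = ∑ j ∈ Finset.range N, Real.exp (-(2 * K + 2)) *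
              (P.real Eᶜ * (1 + (2 * K + 2)) - 1 -
                ∫ h : History n M, historyCost (block n k j) τ h ∂P) := by
            rw [← Finset.mul_sum, Finset.sum_sub_distrib, Finset.sum_const, Finset.card_range,
              nsmul_eq_mul]
        _ ≤ _ := Finset.sum_le_sum fun j _ => le_real_law_compl (block n k j) 𝒜 hτ M hE _
    obtain ⟨j, hj, hle⟩ := Finset.exists_le_of_sum_le (Finset.nonempty_range_iff.2 hNpos.ne') hsum
    refine le_trans ?_ (le_iSup₂ (f := fun S _ => 𝒜.law (τ / (1 + τ)) S M Eᶜ) (block n k j)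
      (hC ⟨j, Finset.mem_range.1 hj, rfl⟩))
    exact (ENNReal.ofReal_le_ofReal hle).trans_eq (ofReal_measureReal)
  · refine le_add_right ?_
    rw [← ofReal_measureReal (μ := P) (s := E)]
    refine ENNReal.ofReal_le_ofReal ?_
    have h1 := probReal_compl_eq_one_sub (μ := P) hE
    have h2 : Real.exp (-(2 * K + 2)) ≤ 1 := Real.exp_le_one_iff.2 (by linarith)
    linarith

/-- A lower bound for the minimax risk of every class that contains the disjoint intervals. -/
theorem le_minimaxRisk {ρ : ℝ} (hρ : 0 ≤ ρ) (hρ2 : ρ ≤ 1 / 2) (hk : 1 ≤ k) (hkn : k ≤ n)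
    {C : Set (Finset (Fin n))} (hC : disjointKIntervals n k ⊆ C) (M : ℕ) :
    ENNReal.ofReal (Real.exp (-(8 * (ρ ^ 2 * k ^ 2 * M / n) + 2)) / 2) ≤ minimaxRisk ρ C M := by
  have h1 : 0 < 1 - ρ := by linarith
  obtain ⟨τ, hτ⟩ : ∃ τ, τ = ρ / (1 - ρ) := ⟨_, rfl⟩
  have hτ0 : 0 ≤ τ := hτ ▸ div_nonneg hρ h1.le
  have hτρ : τ / (1 + τ) = ρ := by
    rw [hτ]
    field_simp
    ring
  -- Passing from `τ` to `ρ` costs a factor 4 in `τ²`, which turns the 2 in the exponent into 8.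
  have hτ2 : τ ≤ 2 * ρ := by
    rw [hτ, div_le_iff₀ h1]
    nlinarith
  refine le_iInf₂ fun 𝒜 h𝒜 => le_iInf₂ fun φ hφ => ?_
  have hB : ∀ᵐ h ∂𝒜.law (τ / (1 + τ)) ∅ M, spent h ≤ M :=
    hτρ ▸ h𝒜 ∅ (Set.mem_insert _ _)
  have h := le_risk hτ0 hk hkn hC M 𝒜 hB hφ
  rw [hτρ] at h
  refine le_trans (ENNReal.ofReal_le_ofReal ?_) h
  have h2 : τ ^ 2 * k ^ 2 * M / n ≤ (2 * ρ) ^ 2 * k ^ 2 * M / n := by gcongr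
  have h3 : (2 * ρ) ^ 2 * k ^ 2 * M / n = 4 * (ρ ^ 2 * k ^ 2 * M / n) := by ring
  refine div_le_div_of_nonneg_right (Real.exp_le_exp.2 ?_) (by norm_num)
  linarith

end Blocks

end

end CorrDetect

/-! ### From the risk bound to divergence of the signal strength -/

theorem corollary1
    (C : (n k : ℕ) → Set (Finset (Fin n)))
    (hC : C = CorrDetect.kSets ∨ C = CorrDetect.kIntervals ∨ C = CorrDetect.disjointKIntervals)
    (n k M : ℕ → ℕ) (ρ : ℕ → ℝ)
    (hk : ∀ᶠ j in atTop, 1 ≤ k j ∧ k j ≤ n j)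
    (hρ : ∀ j, 0 < ρ j)
    (hρk : ρ =o[atTop] fun j => 1 / (k j : ℝ))
    (hrisk : Tendsto (fun j => CorrDetect.minimaxRisk (ρ j) (C (n j) (k j)) (M j))
      atTop (𝓝 0)) :
    Tendsto (fun j => ρ j * (k j : ℝ) * √((M j : ℝ) / (n j : ℝ))) atTop atTop := by
  have hsub (n k : ℕ) : CorrDetect.disjointKIntervals n k ⊆ C n k := by
    rcases hC with rfl | rfl | rfl
    · exact CorrDetect.disjointKIntervals_subset_kSets
    · exact CorrDetect.disjointKIntervals_subset_kIntervals
    · exact subset_rfl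
  refine tendsto_atTop.2 fun b => ?_
  -- The threshold is the lower bound of `le_minimaxRisk` with `ρ² k² m` replaced by `b²`; a risk
  -- below it forces `ρ² k² m > b²`.
  have hpos : 0 < ENNReal.ofReal (Real.exp (-(8 * b ^ 2 + 2)) / 2) :=
    ENNReal.ofReal_pos.2 (by positivity)
  filter_upwards [hk, hρk.def (show (0 : ℝ) < 1 / 2 by norm_num),
    hrisk.eventually (gt_mem_nhds hpos)] with j hkj hρj hj
  have hk1 : (1 : ℝ) ≤ k j := by exact_mod_cast hkj.1
  -- The assumption `ρ = o(1/k)` enters only here, as `ρ ≤ 1/2`.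
  have hρ2 : ρ j ≤ 1 / 2 := by
    rw [Real.norm_of_nonneg (hρ j).le, Real.norm_of_nonneg (by positivity)] at hρj
    have : 1 / (k j : ℝ) ≤ 1 := by
      rw [div_le_one (by linarith)]
      exact hk1
    linarith
  have hlt := (CorrDetect.le_minimaxRisk (hρ j).le hρ2 hkj.1 hkj.2 (hsub _ _) (M j)).trans_lt hj
  rw [ENNReal.ofReal_lt_ofReal_iff (by positivity)] at hlt
  have hexp := Real.exp_lt_exp.1 (by linarith :
    Real.exp (-(8 * (ρ j ^ 2 * k j ^ 2 * M j / n j) + 2)) < Real.exp (-(8 * b ^ 2 + 2)))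
  have hsq : (ρ j * k j * √((M j : ℝ) / n j)) ^ 2 = ρ j ^ 2 * k j ^ 2 * M j / n j := by
    rw [mul_pow, mul_pow, Real.sq_sqrt (by positivity), mul_div_assoc]
  have h0 : 0 ≤ ρ j * k j * √((M j : ℝ) / n j) :=
    mul_nonneg (mul_nonneg (hρ j).le (Nat.cast_nonneg _)) (Real.sqrt_nonneg _)
  -- Squares are compared with only the right-hand quantity known to be nonnegative, so `b` may have
  -- any sign.
  refine (abs_le_of_sq_le_sq' ?_ h0).2
  rw [hsq]
  linarith
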